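/- Conventions. All algebras have a fixed finitary similarity type $\mathscr L$. For an algebra $A$, $\mathrm{Con}\,A$ is the lattice of congruences of $A$, and $\mathrm{Con}_c A$ is the $(\vee,0)$-semilattice of compact congruences. For a homomorphism $f\colon A\to B$ and $\alpha\in\mathrm{Con}\,A$, $(\mathrm{Con}\,f)(\alpha)$ is the congruence of $B$ generated by $\{(f(x),f(y)):(x,y)\in\alpha\}$; $\mathrm{Con}_c f$ is its restriction to compact congruences. For a subalgebra $B$ of $A$ and $\alpha\in\mathrm{Con}\,A$, $B/\alpha$ means $B/(\alpha\cap B^2)$. For a $(\vee,0)$-semilattice $S$, $\mathrm{Id}\,S$ is its lattice of ideals, and $\mathrm{Id}(\tau)$ sends an ideal to the ideal generated by its $\tau$-image; $\mathrm{Con}\,A$ is identified with $\mathrm{Id}(\mathrm{Con}_cA)$. $P^{=}$ is the set of non-maximal elements of a poset $P$. A class $\mathcal V$ of algebras is viewed as a category with all homomorphisms; a lifting in $\mathcal V$ of a functor $\mathcal E\colon C\to\mathcal S$ to $(\vee,0)$-semilattices is a functor $\mathcal B\colon C\to\mathcal V$ with $\mathrm{Con}_c\circ\mathcal B$ naturally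 isomorphic to $\mathcal E$. Löwenheim–Skolem property. Let $P$ be a poset, $J$ a small category, $(\kappa_p)_{p\in P}$ cardinals. A class $\mathcal V$ of algebras is $(P,J,(\kappa_p)_{p\in P})$-Löwenheim–Skolem if for every functor $\mathcal A\colon J\to\mathcal V$ and all congruences $\alpha_p^j\in\mathrm{Con}\,\mathcal A(j)$ with $\sum_{j}|\mathrm{Con}_c(\mathcal A(j)/\alpha_p^j)|<\kappa_p$ for all $p$, there are subalgebras $B_p^j$ of $\mathcal A(j)$ such that, for all $p\le q$ in $P$, all $j$ and all $f\colon j\to k$ in $J$: $B_p^j/\alpha_p^j\in\mathcal V$; $B_p^j\subseteq B_q^j$; $\mathcal A(f)(B_p^j)\subseteq B_p^k$; $\mathrm{Con}$ of the canonical embedding $B_p^j/\alpha_p^j\hookrightarrow\mathcal A(j)/\alpha_p^j$ is an isomorphism; and $\sum_{l}|B_p^l|<\kappa_p$. Norm-coverings. A kernel of a poset $U$ is a finite $V\subseteq U$ such that for each $u\in U$ there is a largest $v\in V$ with $v\le u$, denoted $V\cdot u$; $U$ is supported if each finite subset is contained in a kernel. A norm-covering of a poset $I$ is a supported poset $U$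 with an order-preserving map $|\cdot|\colon U\to I$. An ideal (non-empty, directed lower subset) $\mathbf u$ of $U$ is sharp if $\{|v|:v\in\mathbf u\}$ has a largest element, denoted $|\mathbf u|$; a sharp ideal $\mathbf u$ is extreme if no sharp ideal $\mathbf v\supsetneq\mathbf u$ has $|\mathbf v|=|\mathbf u|$. $\mathrm{Id}_e(U)$ is the set of extreme ideals, ordered by inclusion. For cardinals $\vec\kappa=(\kappa_i)_{i\in I}$, the norm-covering is $\vec\kappa$-compatible if for every order-preserving $F\colon\mathrm{Id}_e(U)\to\mathfrak P(U)$ with $|F(\mathbf u)|<\kappa_{|\mathbf u|}$ for all $\mathbf u\in\mathrm{Id}_e(U)^{=}$ there is an order-preserving $\sigma\colon I\to\mathrm{Id}_e(U)$ with $|\sigma(i)|=i$ for all $i$ and $F(\sigma(i))\cap\sigma(j)\subseteq\sigma(i)$ for all $i\le j$. Condensates and quasi-liftings. Let $\vec D=(D_i,\phi_{i,i'})_{i\le i'}$ be a diagram of $(\vee,0)$-semilattices and $(\vee,0)$-homomorphisms indexed by $I$. $\mathrm{Cond}(\vec D,U)$ is the $(\vee,0)$-semilattice of all $a\in\prod_{u\in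 U}D_{|u|}$ having a support, i.e. a kernel $V$ with $a_u=\phi_{|V\cdot u|,|u|}(a_{V\cdot u})$ for all $u$; it is functorial in $\vec D$, componentwise. For a sharp ideal $\mathbf u$ let $V\cdot\mathbf u$ be the largest element of $V\cap\mathbf u$, $\pi_{\mathbf u}(a)=\phi_{|V\cdot\mathbf u|,|\mathbf u|}(a_{V\cdot\mathbf u})$ for any support $V$ of $a$, and $\theta_{\mathbf u}^{\vec D}=\{a:\pi_{\mathbf u}(a)=0\}$. A $U$-quasi-lifting of $\vec D$ in $\mathcal V$ is a pair $(\tau,T)$ with $T\in\mathcal V$ and $\tau\colon\mathrm{Con}_cT\to\mathrm{Cond}(\vec D,U)$ a $(\vee,0)$-homomorphism such that for every $\mathbf u\in\mathrm{Id}_e(U)$, with $\alpha_{\mathbf u}=\bigvee\{\beta\in\mathrm{Con}_cT:\tau(\beta)\in\theta_{\mathbf u}^{\vec D}\}$, the map $\beta\mapsto\mathrm{Id}(\tau)(\beta)\vee\theta_{\mathbf u}^{\vec D}$ is an isomorphism from $\{\beta\in\mathrm{Con}\,T:\beta\ge\alpha_{\mathbf u}\}$ onto $\{K\in\mathrm{Id}\,\mathrm{Cond}(\vec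 D,U):K\ge\theta_{\mathbf u}^{\vec D}\}$. A $U$-quasi-lifting in $\mathcal V$ of a functor $\mathcal D\colon J\to\mathcal S^I$ is a functor $\mathcal A\colon J\to\mathcal V$ with a natural transformation $\vec\tau\colon\mathrm{Con}_c\circ\mathcal A\to\mathrm{Cond}(\mathcal D(-),U)$ such that $(\tau^j,\mathcal A(j))$ is a $U$-quasi-lifting of $\mathcal D(j)$ for every object $j$. Theorem. Let $\mathcal S$ be the category of all $(\vee,0)$-semilattices and $(\vee,0)$-homomorphisms, $I$ a poset, $\vec\kappa=(\kappa_i)_{i\in I}$ cardinals such that $\kappa_i$ is infinite for every non-maximal $i\in I$, $(U,|\cdot|)$ a $\vec\kappa$-compatible norm-covering of $I$, $J$ a small category, and $\mathcal V$ a class of algebras of the same similarity type that is closed under homomorphic images and $\bigl(\mathrm{Id}_e(U)^{=},J,(\kappa_{|\mathbf u|})_{\mathbf u\in\mathrm{Id}_e(U)^{=}}\bigr)$-Löwenheim–Skolem. Let $\mathcal D\colon J\to\mathcal S^I$ be a functor, $\mathcal D(j)=(D_i^j)_{i\in I}$, with $\sum_{j}|D_i^j|<\kappa_i$ for all $i\in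 I$. If $\mathcal D$ has a $U$-quasi-lifting in $\mathcal V$, then the diagram $\widehat{\mathcal D}\colon I\times J\to\mathcal S$ given by $\widehat{\mathcal D}(i,j)=\mathcal D(j)(i)$ and $\widehat{\mathcal D}(i\le i',g\colon j\to j')=\mathcal D(g)_{i'}\circ\mathcal D(j)(i\le i')$ has a lifting in $\mathcal V$. -/

import Mathlib

open CategoryTheory Cardinal
open scoped FirstOrder

universe u v w

/-! ### Algebras of a fixed similarity type

A similarity type is a first-order language `L` without relation symbols. -/

/-- Algebras of similarity type `L`. -/
structure Alg (L : FirstOrder.Language.{v, w}) where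
  of ::
  carrier : Type u
  [str : L.Structure carrier]

namespace Alg

variable {L : FirstOrder.Language.{v, w}}

instance : CoeSort (Alg.{u} L) (Type u) := ⟨Alg.carrier⟩

instance (A : Alg.{u} L) : L.Structure A := A.str

/-- The category of algebras of similarity type `L` and all homomorphisms. -/
instance : Category.{u} (Alg.{u} L) where
  Hom A B := A →[L] B
  id A := FirstOrder.Language.Hom.id L A
  comp f g := g.comp f

instance : ConcreteCategory (Alg.{u} L) (fun A B => A →[L] B) where
  hom f := f
  ofHom f := f

end Alg

/-! ### Congruences -/

/-- A congruence of the algebra `A`: an equivalence relation compatible with all operations. -/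
structure Congr (L : FirstOrder.Language.{v, w}) (A : Type u) [L.Structure A]
    extends Setoid A where
  funMap_rel : ∀ {n : ℕ} (f : L.Functions n) (x y : Fin n → A), (∀ i, r (x i) (y i)) →
    r (FirstOrder.Language.Structure.funMap f x) (FirstOrder.Language.Structure.funMap f y)

namespace Congr

variable {L : FirstOrder.Language.{v, w}} {A B C : Type u}
  [L.Structure A] [L.Structure B] [L.Structure C]

theorem toSetoid_injective : Function.Injective (toSetoid : Congr L A → Setoid A) := by
  rintro ⟨s, hs⟩ ⟨t, ht⟩ h
  cases h
  rfl

/-- Congruences are ordered by containment. -/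
instance : PartialOrder (Congr L A) := PartialOrder.lift toSetoid toSetoid_injective

theorem le_def {θ ψ : Congr L A} : θ ≤ ψ ↔ ∀ x y, θ.r x y → ψ.r x y :=
  ⟨fun h _ _ hxy => h hxy, fun h _ _ hxy => h _ _ hxy⟩

/-- Arbitrary meets of congruences are intersections. -/
instance : InfSet (Congr L A) where
  sInf S :=
    { r := fun x y => ∀ θ ∈ S, θ.r x y
      iseqv :=
        ⟨fun x θ _ => θ.iseqv.refl x, fun h θ hθ => θ.iseqv.symm (h θ hθ),
          fun h k θ hθ => θ.iseqv.trans (h θ hθ) (k θ hθ)⟩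
      funMap_rel := fun f x y h θ hθ => θ.funMap_rel f x y fun i => h i θ hθ }

/-- The lattice `Con A` of all congruences of `A`. -/
instance : CompleteLattice (Congr L A) :=
  completeLatticeOfInf (Congr L A) fun _ =>
    ⟨fun θ hθ => le_def.2 fun _ _ h => h θ hθ,
      fun _ hψ => le_def.2 fun x y h _ hθ => le_def.1 (hψ hθ) x y h⟩

/-- The smallest congruence containing the set `P` of pairs. -/
def gen (P : Set (A × A)) : Congr L A := sInf {θ | ∀ p ∈ P, θ.r p.1 p.2}

theorem gen_le_iff {P : Set (A × A)} {ψ : Congr L A} : gen P ≤ ψ ↔ ∀ p ∈ P, ψ.r p.1 p.2 :=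
  ⟨fun h p hp => le_def.1 h _ _ fun _ hθ => hθ p hp, fun h => sInf_le h⟩

/-- `(Con f)(θ)`: the congruence of `B` generated by all `(f x, f y)` with `(x, y) ∈ θ`. -/
def map (f : A →[L] B) (θ : Congr L A) : Congr L B :=
  gen {p | ∃ x y, θ.r x y ∧ p = (f x, f y)}

/-- The preimage of a congruence under a homomorphism. For the inclusion of a subalgebra it is the
restriction of the congruence to the subalgebra. -/
def comap (f : A →[L] B) (ψ : Congr L B) : Congr L A where
  r x y := ψ.r (f x) (f y)
  iseqv := ⟨fun _ => ψ.iseqv.refl _, fun h => ψ.iseqv.symm h, fun h k => ψ.iseqv.trans h k⟩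
  funMap_rel g x y h := by
    rw [f.map_fun, f.map_fun]
    exact ψ.funMap_rel g _ _ h

theorem gc (f : A →[L] B) : GaloisConnection (map f) (comap f) := by
  intro θ ψ
  rw [map, gen_le_iff, le_def]
  constructor
  · intro h x y hxy
    exact h _ ⟨x, y, hxy, rfl⟩
  · rintro h _ ⟨x, y, hxy, rfl⟩
    exact h x y hxy

theorem map_id (θ : Congr L A) : map (FirstOrder.Language.Hom.id L A) θ = θ :=
  (gc (FirstOrder.Language.Hom.id L A)).l_unique GaloisConnection.id fun _ => rfl

theorem map_comp (g : B →[L] C) (f : A →[L] B) (θ : Congr L A) :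
    map (g.comp f) θ = map g (map f θ) :=
  (gc (g.comp f)).l_unique ((gc f).compose (gc g)) fun _ => rfl

/-- A directed join of congruences is their union. -/
theorem sSup_rel {S : Set (Congr L A)} (hne : S.Nonempty) (hd : DirectedOn (· ≤ ·) S) {x y : A} :
    (sSup S).r x y ↔ ∃ θ ∈ S, θ.r x y := by
  constructor
  · have hfin : ∀ {n : ℕ} (x y : Fin n → A), (∀ i, ∃ θ ∈ S, θ.r (x i) (y i)) →
        ∃ θ ∈ S, ∀ i, θ.r (x i) (y i) := by
      intro n
      induction n with
      | zero =>
        intro x y _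
        obtain ⟨θ, hθ⟩ := hne
        exact ⟨θ, hθ, fun i => i.elim0⟩
      | succ n ih =>
        intro x y h
        obtain ⟨θ, hθ, h1⟩ := ih (fun i => x i.succ) (fun i => y i.succ) fun i => h i.succ
        obtain ⟨ψ, hψ, h2⟩ := h 0
        obtain ⟨ω, hω, h3, h4⟩ := hd θ hθ ψ hψ
        refine ⟨ω, hω, fun i => ?_⟩
        refine Fin.cases ?_ (fun i => ?_) i
        · exact le_def.1 h4 _ _ h2
        · exact le_def.1 h3 _ _ (h1 i)
    let Ω : Congr L A :=
      { r := fun x y => ∃ θ ∈ S, θ.r x y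
        iseqv :=
          ⟨fun x => hne.imp fun θ hθ => ⟨hθ, θ.iseqv.refl x⟩,
            fun ⟨θ, hθ, h⟩ => ⟨θ, hθ, θ.iseqv.symm h⟩,
            fun ⟨θ, hθ, h⟩ ⟨ψ, hψ, k⟩ => by
              obtain ⟨ω, hω, h1, h2⟩ := hd θ hθ ψ hψ
              exact ⟨ω, hω, ω.iseqv.trans (le_def.1 h1 _ _ h) (le_def.1 h2 _ _ k)⟩⟩
        funMap_rel := fun f x y h => by
          obtain ⟨θ, hθ, h1⟩ := hfin x y h
          exact ⟨θ, hθ, θ.funMap_rel f x y h1⟩ }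
    have hΩ : sSup S ≤ Ω := sSup_le fun θ hθ => le_def.2 fun x y h => ⟨θ, hθ, h⟩
    exact fun h => le_def.1 hΩ x y h
  · rintro ⟨θ, hθ, h⟩
    exact le_def.1 (le_sSup hθ) x y h

theorem isCompactElement_map (f : A →[L] B) {θ : Congr L A} (hθ : IsCompactElement θ) :
    IsCompactElement (map f θ) := by
  intro S ψ hne hd hψ hle
  rw [← hψ.sSup_eq] at hle
  have hd' : DirectedOn (· ≤ ·) (comap f '' S) := by
    rintro _ ⟨a, ha, rfl⟩ _ ⟨b, hb, rfl⟩
    obtain ⟨c, hc, h1, h2⟩ := hd a ha b hb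
    exact ⟨_, ⟨c, hc, rfl⟩, (gc f).monotone_u h1, (gc f).monotone_u h2⟩
  have h1 : θ ≤ sSup (comap f '' S) := by
    refine ((gc f).le_u hle).trans (le_def.2 fun x y hxy => ?_)
    obtain ⟨ω, hω, h⟩ := (sSup_rel hne hd).1 hxy
    exact (sSup_rel (hne.image _) hd').2 ⟨_, ⟨ω, hω, rfl⟩, h⟩
  obtain ⟨_, ⟨ω, hω, rfl⟩, h⟩ := hθ _ _ (hne.image _) hd' (isLUB_sSup _) h1
  exact ⟨ω, hω, (gc f).l_le h⟩

theorem isCompactElement_bot : IsCompactElement (⊥ : Congr L A) :=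
  fun _ _ hne _ _ _ => hne.imp fun _ hθ => ⟨hθ, bot_le⟩

theorem isCompactElement_sup {θ ψ : Congr L A} (hθ : IsCompactElement θ)
    (hψ : IsCompactElement ψ) : IsCompactElement (θ ⊔ ψ) := by
  intro S ω hne hd hω hle
  obtain ⟨a, ha, h1⟩ := hθ S ω hne hd hω (le_sup_left.trans hle)
  obtain ⟨b, hb, h2⟩ := hψ S ω hne hd hω (le_sup_right.trans hle)
  obtain ⟨c, hc, h3, h4⟩ := hd a ha b hb
  exact ⟨c, hc, sup_le (h1.trans h3) (h2.trans h4)⟩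

/-- The quotient `A / θ` is an algebra. -/
instance instPrestructure [L.IsAlgebraic] (θ : Congr L A) : L.Prestructure θ.toSetoid where
  toStructure := inferInstance
  fun_equiv {_ f} x y h := θ.funMap_rel f x y h
  rel_equiv {_ r} := isEmptyElim r

/-- The quotient algebra `A / θ`. -/
abbrev QuotAlg [L.IsAlgebraic] (θ : Congr L A) : Type u := Quotient θ.toSetoid

/-- For a subalgebra `B` of `A`, the canonical embedding of `B / θ`, that is, of the quotient of `B`
by the restriction of `θ`, into `A / θ`. -/
def canonicalEmbedding [L.IsAlgebraic] (B : L.Substructure A) (θ : Congr L A) :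
    QuotAlg (comap B.subtype.toHom θ) →[L] QuotAlg θ where
  toFun := Quotient.map' (fun b => (b : A)) fun _ _ h => h
  map_fun' {n} f x := by
    obtain ⟨y, rfl⟩ : ∃ y : Fin n → B, (fun i => (Quotient.mk _ (y i) :
        QuotAlg (comap B.subtype.toHom θ))) = x :=
      ⟨fun i => (x i).out, funext fun i => Quotient.out_eq (x i)⟩
    rw [FirstOrder.Language.funMap_quotient_mk']
    exact (FirstOrder.Language.funMap_quotient_mk' θ.toSetoid f fun i => (y i : A)).symm
  map_rel' r := isEmptyElim r

end Congr

/-! ### The functor of compact congruences -/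

/-- The set `Con_c A` of all compact congruences of `A`. -/
abbrev Conc (L : FirstOrder.Language.{v, w}) (A : Type u) [L.Structure A] : Type u :=
  {θ : Congr L A // IsCompactElement θ}

namespace Conc

variable {L : FirstOrder.Language.{v, w}} {A B : Type u} [L.Structure A] [L.Structure B]

/-- `Con_c A` is a `(∨, 0)`-semilattice, with the joins of `Con A`. -/
instance : SemilatticeSup (Conc L A) :=
  Subtype.semilatticeSup fun _ _ hθ hψ => Congr.isCompactElement_sup hθ hψ

instance : OrderBot (Conc L A) := Subtype.orderBot Congr.isCompactElement_bot

/-- `Con_c f` is the restriction of `Con f`. -/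
def map (f : A →[L] B) : SupBotHom (Conc L A) (Conc L B) where
  toFun θ := ⟨Congr.map f θ.1, Congr.isCompactElement_map f θ.2⟩
  map_sup' _ _ := Subtype.ext (Congr.gc f).l_sup
  map_bot' := Subtype.ext (Congr.gc f).l_bot

/-- The congruence `θ` viewed as the ideal `{γ | γ ≤ θ}` of `Con_c A`. -/
def idealOf (θ : Congr L A) : Order.Ideal (Conc L A) where
  carrier := {γ | γ.1 ≤ θ}
  lower' _ _ h hθ := le_trans (α := Congr L A) h hθ
  nonempty' := ⟨⊥, bot_le (α := Congr L A)⟩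
  directed' γ hγ δ hδ := ⟨γ ⊔ δ, sup_le (α := Congr L A) hγ hδ, le_sup_left, le_sup_right⟩

end Conc

/-- The functor `Con_c` from algebras to `(∨, 0)`-semilattices. -/
def concFunctor (L : FirstOrder.Language.{v, w}) : Alg.{u} L ⥤ SemilatSupCat.{u} where
  obj A := SemilatSupCat.of (Conc L A)
  map f := Conc.map f
  map_id _ := SupBotHom.ext fun θ => Subtype.ext (Congr.map_id θ.1)
  map_comp f g := SupBotHom.ext fun θ => Subtype.ext (Congr.map_comp g f θ.1)

/-- `Id f`: it sends an ideal `K` to the ideal generated by the image of `K` under `f`. -/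
def SupBotHom.idealMap {P Q : Type*} [SemilatticeSup P] [OrderBot P] [SemilatticeSup Q]
    [OrderBot Q] (f : SupBotHom P Q) (K : Order.Ideal P) : Order.Ideal Q where
  carrier := {b | ∃ a ∈ K, b ≤ f a}
  lower' _ _ h := fun ⟨a, ha, hb⟩ => ⟨a, ha, le_trans h hb⟩
  nonempty' := ⟨f ⊥, ⊥, K.bot_mem, le_rfl⟩
  directed' := by
    rintro x ⟨a, ha, hx⟩ y ⟨b, hb, hy⟩
    refine ⟨x ⊔ y, ⟨a ⊔ b, K.sup_mem ha hb, ?_⟩, le_sup_left, le_sup_right⟩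
    rw [map_sup]
    exact sup_le_sup hx hy

/-- The map `f` is an isomorphism of ordered sets. -/
def IsOrderIso {P Q : Type*} [LE P] [LE Q] (f : P → Q) : Prop :=
  ∃ e : P ≃o Q, ∀ p, e p = f p

/-! ### Classes of algebras -/

/-- The class `V` is closed under homomorphic images. -/
def ClosedUnderHomImages {L : FirstOrder.Language.{v, w}} (V : Alg.{u} L → Prop) : Prop :=
  ∀ (A B : Alg.{u} L) (f : A →[L] B), Function.Surjective f → V A → V B

/-- The class `V` is `(P, J, κ)`-Löwenheim–Skolem. -/
def IsLowenheimSkolem {L : FirstOrder.Language.{v, w}} [L.IsAlgebraic] (V : Alg.{u} L → Prop)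
    (P : Type u) [PartialOrder P] (J : Type u) [SmallCategory J] (κ : P → Cardinal.{u}) : Prop :=
  ∀ A : J ⥤ Alg.{u} L, (∀ j, V (A.obj j)) →
    ∀ α : (p : P) → (j : J) → Congr L (A.obj j),
      (∀ p, Cardinal.sum (fun j => #(Conc L (α p j).QuotAlg)) < κ p) →
      ∃ B : (p : P) → (j : J) → L.Substructure (A.obj j),
        (∀ p j, V (Alg.of ((α p j).comap (B p j).subtype.toHom).QuotAlg)) ∧
        (∀ p q j, p ≤ q → B p j ≤ B q j) ∧
        (∀ p (j k : J) (f : j ⟶ k), ∀ x ∈ B p j, A.map f x ∈ B p k) ∧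
        (∀ p j, IsOrderIso (Congr.map ((α p j).canonicalEmbedding (B p j)))) ∧
        ∀ p, Cardinal.sum (fun j => #(B p j)) < κ p

/-- `A` is a lifting in `V` of the diagram `D` of `(∨, 0)`-semilattices. -/
def IsLifting {L : FirstOrder.Language.{v, w}} (V : Alg.{u} L → Prop) {C : Type*} [Category C]
    (D : C ⥤ SemilatSupCat.{u}) (A : C ⥤ Alg.{u} L) : Prop :=
  (∀ c, V (A.obj c)) ∧ Nonempty (A ⋙ concFunctor L ≅ D)

/-! ### Kernels, supported posets, norm-coverings -/

/-- The finite subset `V` of `U` is a kernel: below each `p` there is a largest element of `V`. -/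
def IsKernel {U : Type u} [PartialOrder U] (V : Finset U) : Prop :=
  ∀ p : U, ∃ q, IsGreatest {x | x ∈ V ∧ x ≤ p} q

/-- The poset `U` is supported. -/
def IsSupported (U : Type u) [PartialOrder U] : Prop :=
  ∀ X : Finset U, ∃ V : Finset U, X ⊆ V ∧ IsKernel V

/-- For a kernel `V` and an ideal `p` there is a largest element of `V ∩ p`. -/
theorem IsKernel.exists_isGreatest {U : Type u} [PartialOrder U] {V : Finset U} (hV : IsKernel V)
    (p : Order.Ideal U) : ∃ q, IsGreatest {x | x ∈ V ∧ x ∈ p} q := by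
  have h : ∀ W : Finset U, ∃ z ∈ p, ∀ x ∈ W, x ∈ p → x ≤ z := by
    classical
    intro W
    induction W using Finset.induction_on with
    | empty =>
      obtain ⟨z, hz⟩ := p.nonempty
      exact ⟨z, hz, by simp⟩
    | insert a W _ ih =>
      obtain ⟨z, hz, h⟩ := ih
      by_cases ha : a ∈ p
      · obtain ⟨t, ht, h1, h2⟩ := p.directed z hz a ha
        refine ⟨t, ht, fun x hx hxp => ?_⟩
        rcases Finset.mem_insert.1 hx with rfl | hx
        · exact h2
        · exact (h x hx hxp).trans h1
      · refine ⟨z, hz, fun x hx hxp => ?_⟩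
        rcases Finset.mem_insert.1 hx with rfl | hx
        · exact absurd hxp ha
        · exact h x hx hxp
  obtain ⟨z, hz, h⟩ := h V
  obtain ⟨q, ⟨hq, hqz⟩, hmax⟩ := hV z
  exact ⟨q, ⟨hq, p.lower hqz hz⟩, fun x hx => hmax ⟨hx.1, h x hx.1 hx.2⟩⟩

/-- A norm-covering of the poset `I`: a supported poset `U` with an order-preserving map to `I`. -/
structure NormCovering (I U : Type u) [PartialOrder I] [PartialOrder U] where
  norm : U →o I
  supported : IsSupported U

namespace NormCovering

variable {I U : Type u} [PartialOrder I] [PartialOrder U] (N : NormCovering I U)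

/-- The sharp ideals, ordered by inclusion: the set of norms of the elements has a largest
element. -/
abbrev SharpIdeal : Type u :=
  {p : Order.Ideal U // ∃ i, IsGreatest (N.norm '' (p : Set U)) i}

variable {N}

/-- The norm of a sharp ideal. -/
noncomputable def SharpIdeal.norm (p : N.SharpIdeal) : I := p.2.choose

theorem SharpIdeal.norm_le (p : N.SharpIdeal) {x : U} (hx : x ∈ p.1) : N.norm x ≤ p.norm :=
  p.2.choose_spec.2 ⟨x, hx, rfl⟩

variable (N)

/-- The extreme ideals, ordered by inclusion: the sharp ideals that are maximal among the sharp
ideals of the same norm. -/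
abbrev ExtremeIdeal : Type u :=
  {p : N.SharpIdeal // ¬ ∃ q : N.SharpIdeal, p < q ∧ q.norm = p.norm}

/-- The norm-covering is `κ`-compatible. -/
def IsCompatible (κ : I → Cardinal.{u}) : Prop :=
  ∀ F : N.ExtremeIdeal →o Set U,
    (∀ p : N.ExtremeIdeal, ¬ IsMax p → #(F p) < κ p.1.norm) →
    ∃ σ : I →o N.ExtremeIdeal,
      (∀ i, (σ i).1.norm = i) ∧
      ∀ i j, i ≤ j → F (σ i) ∩ ((σ j).1.1 : Set U) ⊆ ((σ i).1.1 : Set U)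

/-! ### Condensates -/

/-- The kernel `V` is a support of `a`: for each `p`, if `q` is the largest element of `V` below
`p`, then `a p` is the image of `a q` under the transition map. -/
def IsSupport (D : I ⥤ SemilatSupCat.{u}) (V : Finset U)
    (a : (p : U) → D.obj (N.norm p)) : Prop :=
  IsKernel V ∧ ∀ (p q : U) (h : IsGreatest {x | x ∈ V ∧ x ≤ p} q),
    a p = D.map (homOfLE (N.norm.monotone h.1.2)) (a q)

variable {N}

theorem map_map_apply (D : I ⥤ SemilatSupCat.{u}) {i j k : I} (f : i ⟶ j) (g : j ⟶ k)
    (h : i ⟶ k) (x : D.obj i) : D.map g (D.map f x) = D.map h x := by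
  have e : h = f ≫ g := Subsingleton.elim _ _
  rw [e, D.map_comp]
  rfl

theorem map_self_apply (D : I ⥤ SemilatSupCat.{u}) {i : I} (f : i ⟶ i) (x : D.obj i) :
    D.map f x = x := by
  have e : f = 𝟙 i := Subsingleton.elim _ _
  rw [e, D.map_id]
  rfl

theorem IsSupport.mono {D : I ⥤ SemilatSupCat.{u}} {V W : Finset U}
    {a : (p : U) → D.obj (N.norm p)} (h : N.IsSupport D V a) (hVW : V ⊆ W) (hW : IsKernel W) :
    N.IsSupport D W a := by
  refine ⟨hW, fun p q hq => ?_⟩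
  obtain ⟨r, hr⟩ := h.1 p
  have hrq : r ≤ q := hq.2 ⟨hVW hr.1.1, hr.1.2⟩
  have hr' : IsGreatest {x | x ∈ V ∧ x ≤ q} r :=
    ⟨⟨hr.1.1, hrq⟩, fun x hx => hr.2 ⟨hx.1, hx.2.trans hq.1.2⟩⟩
  rw [h.2 p r hr, h.2 q r hr', map_map_apply]

theorem IsSupport.exists_common {D : I ⥤ SemilatSupCat.{u}} {V W : Finset U}
    {a b : (p : U) → D.obj (N.norm p)} (ha : N.IsSupport D V a) (hb : N.IsSupport D W b) :
    ∃ X : Finset U, V ⊆ X ∧ W ⊆ X ∧ N.IsSupport D X a ∧ N.IsSupport D X b := by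
  classical
  obtain ⟨X, hX, hK⟩ := N.supported (V ∪ W)
  have hV := Finset.subset_union_left.trans hX
  have hW := Finset.subset_union_right.trans hX
  exact ⟨X, hV, hW, ha.mono hV hK, hb.mono hW hK⟩

variable (N)

/-- The condensate `Cond(D, U)`: all elements of the product of the `D (norm p)` that have a
support. -/
abbrev Cond (D : I ⥤ SemilatSupCat.{u}) : Type u :=
  {a : (p : U) → D.obj (N.norm p) // ∃ V, N.IsSupport D V a}

/-- The condensate is a `(∨, 0)`-semilattice, with componentwise operations. -/
instance (D : I ⥤ SemilatSupCat.{u}) : SemilatticeSup (N.Cond D) :=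
  Subtype.semilatticeSup <| by
    rintro a b ⟨V, hV⟩ ⟨W, hW⟩
    obtain ⟨X, -, -, ha, hb⟩ := hV.exists_common hW
    refine ⟨X, ha.1, fun p q h => ?_⟩
    rw [Pi.sup_apply, ha.2 p q h, hb.2 p q h, Pi.sup_apply, map_sup]

instance (D : I ⥤ SemilatSupCat.{u}) : OrderBot (N.Cond D) :=
  Subtype.orderBot <| by
    obtain ⟨V, -, hV⟩ := N.supported ∅
    exact ⟨V, hV, fun p q h => 
      (map_bot (ConcreteCategory.hom (D.map (homOfLE (N.norm.monotone h.1.2))))).symm⟩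

/-- The condensate functor `Cond(-, U)`. -/
def condFunctor : (I ⥤ SemilatSupCat.{u}) ⥤ SemilatSupCat.{u} where
  obj D := SemilatSupCat.of (N.Cond D)
  map {D E} h :=
    { toFun := fun a => ⟨fun p => h.app (N.norm p) (a.1 p), by
        obtain ⟨V, hV⟩ := a.2
        refine ⟨V, hV.1, fun p q hq => ?_⟩
        change h.app (N.norm p) (a.1 p) = E.map _ (h.app (N.norm q) (a.1 q))
        rw [hV.2 p q hq]
        exact ConcreteCategory.congr_hom (h.naturality (homOfLE (N.norm.monotone hq.1.2))) (a.1 q)⟩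
      map_sup' := fun a b => Subtype.ext <| funext fun p =>
        map_sup (ConcreteCategory.hom (h.app (N.norm p))) (a.1 p) (b.1 p)
      map_bot' := Subtype.ext <| funext fun p =>
        map_bot (ConcreteCategory.hom (h.app (N.norm p))) }
  map_id _ := rfl
  map_comp _ _ := rfl

variable {N}

/-- The canonical projection from the condensate to `D (norm p)`, for a sharp ideal `p`: if `V` is
a support of `a` and `q` is the largest element of `V ∩ p`, then `a` is sent to the image of `a q`
under the transition map. It does not depend on the support, see `proj_eq`. -/
noncomputable def proj (D : I ⥤ SemilatSupCat.{u}) (p : N.SharpIdeal) (a : N.Cond D) :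
    D.obj p.norm :=
  D.map (homOfLE (p.norm_le (a.2.choose_spec.1.exists_isGreatest p.1).choose_spec.1.2))
    (a.1 (a.2.choose_spec.1.exists_isGreatest p.1).choose)

theorem proj_eq (D : I ⥤ SemilatSupCat.{u}) (p : N.SharpIdeal) (a : N.Cond D) {V : Finset U}
    (hV : N.IsSupport D V a.1) {q : U} (hq : IsGreatest {x | x ∈ V ∧ x ∈ p.1} q) :
    proj D p a = D.map (homOfLE (p.norm_le hq.1.2)) (a.1 q) := by
  have key : ∀ {V X : Finset U} {q r : U}, V ⊆ X → N.IsSupport D V a.1 →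
      ∀ (hq : IsGreatest {x | x ∈ V ∧ x ∈ p.1} q) (hr : IsGreatest {x | x ∈ X ∧ x ∈ p.1} r),
        D.map (homOfLE (p.norm_le hq.1.2)) (a.1 q) =
          D.map (homOfLE (p.norm_le hr.1.2)) (a.1 r) := by
    intro V X q r hVX hV hq hr
    have hqr : q ≤ r := hr.2 ⟨hVX hq.1.1, hq.1.2⟩
    have h : IsGreatest {x | x ∈ V ∧ x ≤ r} q :=
      ⟨⟨hq.1.1, hqr⟩, fun x hx => hq.2 ⟨hx.1, p.1.lower hx.2 hr.1.2⟩⟩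
    rw [hV.2 r q h, map_map_apply]
  obtain ⟨X, h1, h2, hX, -⟩ := a.2.choose_spec.exists_common hV
  obtain ⟨r, hr⟩ := hX.1.exists_isGreatest p.1
  exact (key h1 a.2.choose_spec (a.2.choose_spec.1.exists_isGreatest p.1).choose_spec hr).trans
    (key h2 hV hq hr).symm

theorem proj_sup (D : I ⥤ SemilatSupCat.{u}) (p : N.SharpIdeal) (a b : N.Cond D) :
    proj D p (a ⊔ b) = proj D p a ⊔ proj D p b := by
  obtain ⟨V, hV⟩ := a.2
  obtain ⟨W, hW⟩ := b.2
  obtain ⟨Y, hY⟩ := (a ⊔ b).2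
  obtain ⟨X, -, -, ha, hb⟩ := hV.exists_common hW
  obtain ⟨Z, h1, h2, hZ, hab⟩ := ha.exists_common hY
  have hZb : N.IsSupport D Z b.1 := hb.mono h1 hZ.1
  obtain ⟨q, hq⟩ := hZ.1.exists_isGreatest p.1
  rw [proj_eq D p a hZ hq, proj_eq D p b hZb hq, proj_eq D p (a ⊔ b) hab hq, ← map_sup]
  rfl

theorem proj_bot (D : I ⥤ SemilatSupCat.{u}) (p : N.SharpIdeal) :
    proj D p (⊥ : N.Cond D) = ⊥ :=
  map_bot (ConcreteCategory.hom (D.map _))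

theorem proj_mono (D : I ⥤ SemilatSupCat.{u}) (p : N.SharpIdeal) : Monotone (proj (N := N) D p) :=
  fun a b h => by
    have e := proj_sup D p a b
    rw [sup_eq_right.2 h] at e
    exact sup_eq_right.1 e.symm

/-- The ideal `θ` of the condensate at `p`: the elements whose canonical projection is `0`. -/
def theta (D : I ⥤ SemilatSupCat.{u}) (p : N.SharpIdeal) : Order.Ideal (N.Cond D) where
  carrier := {a | proj D p a = ⊥}
  lower' a b h ha := le_bot_iff.1 ((proj_mono D p h).trans (le_of_eq ha))
  nonempty' := ⟨⊥, proj_bot D p⟩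
  directed' a ha b hb := by
    refine ⟨a ⊔ b, ?_, le_sup_left, le_sup_right⟩
    change proj D p (a ⊔ b) = ⊥
    rw [proj_sup, show proj D p a = ⊥ from ha, show proj D p b = ⊥ from hb, sup_idem]

/-! ### Quasi-liftings -/

/-- The congruence `α` of `T` at `p`: the join of all compact congruences that `τ` sends into
`θ`. -/
def alpha {L : FirstOrder.Language.{v, w}} {D : I ⥤ SemilatSupCat.{u}} {T : Type u}
    [L.Structure T] (τ : SupBotHom (Conc L T) (N.Cond D)) (p : N.SharpIdeal) : Congr L T :=
  sSup {β | ∃ γ : Conc L T, γ.1 = β ∧ τ γ ∈ theta D p}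

/-- `(τ, T)` is a quasi-lifting of the object `D`, apart from the membership of `T` in the class:
for each extreme ideal `p`, the map `β ↦ Id(τ)(β) ∨ θ` is an isomorphism from the
congruences above `α` to the ideals above `θ`. -/
def IsQuasiLiftingHom {L : FirstOrder.Language.{v, w}} {D : I ⥤ SemilatSupCat.{u}} {T : Type u}
    [L.Structure T] (τ : SupBotHom (Conc L T) (N.Cond D)) : Prop :=
  ∀ p : N.ExtremeIdeal,
    IsOrderIso fun β : Set.Ici (alpha τ p.1) =>
      (⟨τ.idealMap (Conc.idealOf β.1) ⊔ theta D p.1,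
        le_sup_right (α := Order.Ideal (N.Cond D))⟩ : Set.Ici (theta D p.1))

/-- `(τ, A)` is a quasi-lifting in `V` of the functor `D` from `J` to diagrams over `I`. -/
def IsQuasiLifting {L : FirstOrder.Language.{v, w}} (V : Alg.{u} L → Prop) {J : Type u}
    [SmallCategory J] (N : NormCovering I U) (D : J ⥤ I ⥤ SemilatSupCat.{u}) (A : J ⥤ Alg.{u} L)
    (τ : A ⋙ concFunctor L ⟶ D ⋙ N.condFunctor) : Prop :=
  (∀ j, V (A.obj j)) ∧
    ∀ j, IsQuasiLiftingHom (N := N) (D := D.obj j) (L := L) (T := A.obj j) (τ.app j)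

end NormCovering

/-- The diagram over `I × J` associated to a functor `D` from `J` to diagrams over `I`. It sends
`(i, j)` to `D(j)(i)` and `(i ≤ i', g : j ⟶ j')` to `D(g)_{i'} ∘ D(j)(i ≤ i')`. -/
abbrev hatDiagram {I J : Type u} [PartialOrder I] [SmallCategory J]
    (D : J ⥤ I ⥤ SemilatSupCat.{u}) : I × J ⥤ SemilatSupCat.{u} :=
  Functor.uncurry.obj D.flip

/-! For an extreme ideal `p` of `U`, the map `γ ↦ proj D p (τ γ)` sends `Con_c T` onto `D (norm p)`
and satisfies `proj (τ γ) ≤ proj (τ δ)` exactly when `γ ≤ δ ∨ α_p`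
(`IsQuasiLiftingHom.proj_surjective`, `IsQuasiLiftingHom.proj_le_iff`). Hence `Con_c (T / α_p)` is
isomorphic to `D (norm p)`, and the cardinality assumption on `D` lets the Löwenheim–Skolem property
replace `A j / α_p` by a small subquotient `B p j / α_p` with the same congruences, for every
non-maximal `p`. For maximal `p` the whole algebra is kept.

Each `τ γ` has a finite support. Let `F p` collect the supports for the principal congruences of
pairs from `B p j`, over all `j`; this set has fewer than `κ (norm p)` elements when `p` is not
maximal. Compatibility gives `σ` with `F (σ i) ∩ σ i' ⊆ σ i` for `i ≤ i'`. So for `x, y` in `B (σ i)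
j`, the projections at `σ i` and `σ i'` of the value of `τ` at the pair read the same coordinate,
and the second is the transition image of the first (`proj_eq_map_proj`).

Therefore the maps of `A` carry `α` at `σ i` into `α` at `σ i'` on these subalgebras, and the
subquotients form a diagram over `I × J`. The isomorphisms onto `D` are natural on principal
congruences, hence everywhere (`Conc.hom_ext`). -/

namespace Congr

/-! ### Principal congruences and quotient algebras. -/

variable {L : FirstOrder.Language.{v, w}} {A B : Type u} [L.Structure A] [L.Structure B]

theorem gen_pair_le_iff {x y : A} {ψ : Congr L A} : gen {(x, y)} ≤ ψ ↔ ψ.r x y := by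
  simp [gen_le_iff]

theorem isCompactElement_gen_pair (x y : A) : IsCompactElement (gen {(x, y)} : Congr L A) := by
  intro S ψ hne hd hψ hle
  rw [← hψ.sSup_eq, gen_pair_le_iff, sSup_rel hne hd] at hle
  obtain ⟨θ, hθ, h⟩ := hle
  exact ⟨θ, hθ, gen_pair_le_iff.2 h⟩

theorem map_gen_pair (f : A →[L] B) (x y : A) :
    map f (gen {(x, y)}) = gen {(f x, f y)} :=
  eq_of_forall_ge_iff fun ψ => by
    rw [gc f _ _, gen_pair_le_iff, gen_pair_le_iff]
    rfl

/-- For a surjective homomorphism with kernel `α`, the preimage of the image of `θ` is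
`θ ∨ α`. -/
theorem comap_map_of_surjective {f : A →[L] B} (hf : Function.Surjective f) {α : Congr L A}
    (hα : ∀ x y, f x = f y ↔ α.r x y) (θ : Congr L A) : comap f (map f θ) = θ ⊔ α := by
  have hle : ∀ {x y}, f x = f y → (θ ⊔ α).r x y := fun h =>
    le_def.1 le_sup_right _ _ ((hα _ _).1 h)
  apply le_antisymm
  -- `χ` is the image of the relation `θ ⊔ α`. It is transitive because points with the same image
  -- are already related by `α`.
  · let χ : Congr L B :=
      { r := fun a b => ∃ x y, f x = a ∧ f y = b ∧ (θ ⊔ α).r x y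
        iseqv :=
          ⟨fun a => by
            obtain ⟨x, rfl⟩ := hf a
            exact ⟨x, x, rfl, rfl, (θ ⊔ α).iseqv.refl x⟩,
          fun ⟨x, y, hx, hy, h⟩ => ⟨y, x, hy, hx, (θ ⊔ α).iseqv.symm h⟩,
          fun ⟨x, y, hx, hy, h⟩ ⟨z, t, hz, ht, k⟩ =>
            ⟨x, t, hx, ht, (θ ⊔ α).iseqv.trans h
              ((θ ⊔ α).iseqv.trans (hle (hy.trans hz.symm)) k)⟩⟩
        funMap_rel := fun g a b h => by
          choose x y hx hy hxy using h
          obtain rfl : (fun i => f (x i)) = a := funext hx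
          obtain rfl : (fun i => f (y i)) = b := funext hy
          exact ⟨_, _, f.map_fun g x, f.map_fun g y, (θ ⊔ α).funMap_rel g x y hxy⟩ }
    have hχ : map f θ ≤ χ := (gc f _ _).2 <| le_def.2 fun x y h =>
      ⟨x, y, rfl, rfl, le_def.1 le_sup_left _ _ h⟩
    refine le_def.2 fun x y h => ?_
    obtain ⟨x', y', hx, hy, h'⟩ := le_def.1 hχ _ _ h
    exact (θ ⊔ α).iseqv.trans (hle hx.symm) ((θ ⊔ α).iseqv.trans h' (hle hy))
  · refine sup_le ((gc f).le_u_l θ) (le_def.2 fun x y h => ?_)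
    change (map f θ).r (f x) (f y)
    rw [(hα x y).2 h]

/-- The canonical projection of `A` onto `A / θ`. -/
def quotHom [L.IsAlgebraic] (θ : Congr L A) : A →[L] θ.QuotAlg where
  toFun x := Quotient.mk _ x
  map_fun' f x := (FirstOrder.Language.funMap_quotient_mk' θ.toSetoid f x).symm
  map_rel' r := isEmptyElim r

theorem quotHom_surjective [L.IsAlgebraic] (θ : Congr L A) : Function.Surjective θ.quotHom :=
  Quotient.mk_surjective

theorem quotHom_eq_iff [L.IsAlgebraic] (θ : Congr L A) (x y : A) :
    θ.quotHom x = θ.quotHom y ↔ θ.r x y :=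
  Quotient.eq

/-- Homomorphisms out of quotient algebras. -/
def quotLift [L.IsAlgebraic] (θ : Congr L A) (f : A →[L] B) (h : ∀ x y, θ.r x y → f x = f y) :
    θ.QuotAlg →[L] B where
  toFun := Quotient.lift f h
  map_fun' {n} g x := by
    obtain ⟨y, rfl⟩ : ∃ y : Fin n → A, (fun i => θ.quotHom (y i)) = x :=
      ⟨fun i => (x i).out, funext fun i => Quotient.out_eq (x i)⟩
    change Quotient.lift f h (FirstOrder.Language.Structure.funMap g (θ.quotHom ∘ y)) = _
    rw [← θ.quotHom.map_fun]
    exact f.map_fun g y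
  map_rel' r := isEmptyElim r

end Congr

/-! ### Compact congruences and their behaviour under homomorphisms. -/

namespace Conc

variable {L : FirstOrder.Language.{v, w}} {A B : Type u} [L.Structure A] [L.Structure B]

/-- The principal congruence generated by `(x, y)`. -/
def principal (x y : A) : Conc L A := ⟨Congr.gen {(x, y)}, Congr.isCompactElement_gen_pair x y⟩

theorem map_principal (f : A →[L] B) (x y : A) :
    map f (principal x y) = principal (f x) (f y) :=
  Subtype.ext (Congr.map_gen_pair f x y)

theorem coe_sup (γ δ : Conc L A) : (γ ⊔ δ).1 = γ.1 ⊔ δ.1 := rfl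

/-- Every pair of `θ` generates a principal congruence below `θ`, so any family containing the
principal ones suffices. The predicate `P` is free so as to serve both the induction principle and
the trivial choice. -/
theorem isLUB_of_forall_principal {P : Conc L A → Prop} (h : ∀ x y, P (principal x y))
    (θ : Congr L A) : IsLUB {ψ | ∃ γ : Conc L A, P γ ∧ γ.1 = ψ ∧ γ.1 ≤ θ} θ := by
  refine ⟨?_, fun ψ hψ => Congr.le_def.2 fun x y hxy => ?_⟩
  · rintro _ ⟨γ, -, rfl, hγ⟩
    exact hγ
  · exact Congr.gen_pair_le_iff.1
      (hψ ⟨principal x y, h x y, rfl, Congr.gen_pair_le_iff.2 hxy⟩)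

/-- Compact congruences are finite joins of principal ones. -/
theorem induction {P : Conc L A → Prop} (hbot : P ⊥) (hsup : ∀ γ δ, P γ → P δ → P (γ ⊔ δ))
    (hpr : ∀ x y, P (principal x y)) (γ : Conc L A) : P γ := by
  have hd : DirectedOn (· ≤ ·) {ψ | ∃ δ : Conc L A, P δ ∧ δ.1 = ψ ∧ δ.1 ≤ γ.1} := by
    rintro _ ⟨δ, h1, rfl, h2⟩ _ ⟨ε, h3, rfl, h4⟩
    exact ⟨_, ⟨δ ⊔ ε, hsup _ _ h1 h3, rfl, sup_le (α := Congr L A) h2 h4⟩,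
      le_sup_left (α := Congr L A), le_sup_right (α := Congr L A)⟩
  have hne : {ψ | ∃ δ : Conc L A, P δ ∧ δ.1 = ψ ∧ δ.1 ≤ γ.1}.Nonempty :=
    ⟨_, ⊥, hbot, rfl, bot_le (α := Congr L A)⟩
  -- Compactness of `γ` picks one member of a directed family below `γ` that is also above it.
  obtain ⟨_, ⟨δ, hδ, rfl, hle⟩, h⟩ := γ.2 _ γ.1 hne hd (isLUB_of_forall_principal hpr γ.1) le_rfl
  obtain rfl : δ = γ := Subtype.ext (le_antisymm hle h)
  exact hδ

theorem hom_ext {S : Type*} [SemilatticeSup S] [OrderBot S] {f g : SupBotHom (Conc L A) S}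
    (h : ∀ x y, f (principal x y) = g (principal x y)) : f = g :=
  SupBotHom.ext <| induction (by rw [map_bot, map_bot])
    (fun γ δ hγ hδ => by rw [map_sup, map_sup, hγ, hδ]) h

/-- As a left adjoint, `Congr.map f` preserves joins, so the image of `θ` is the directed join of
the images of the compact congruences below `θ`; compactness selects one of them. -/
theorem exists_le_of_isCompactElement_map (f : A →[L] B) (θ : Congr L A)
    (h : IsCompactElement (Congr.map f θ)) :
    ∃ γ : Conc L A, γ.1 ≤ θ ∧ Congr.map f γ.1 = Congr.map f θ := by
  have hlub := isLUB_of_forall_principal (L := L) (A := A) (P := fun _ => True)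
    (fun _ _ => trivial) θ
  have hd : DirectedOn (· ≤ ·)
      (Congr.map f '' {ψ | ∃ γ : Conc L A, True ∧ γ.1 = ψ ∧ γ.1 ≤ θ}) := by
    rintro _ ⟨_, ⟨δ, -, rfl, h2⟩, rfl⟩ _ ⟨_, ⟨ε, -, rfl, h4⟩, rfl⟩
    exact ⟨_, ⟨_, ⟨δ ⊔ ε, trivial, rfl, sup_le (α := Congr L A) h2 h4⟩, rfl⟩,
      (Congr.gc f).monotone_l (le_sup_left (α := Congr L A)),
      (Congr.gc f).monotone_l (le_sup_right (α := Congr L A))⟩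
  have hne : (Congr.map f '' {ψ | ∃ γ : Conc L A, True ∧ γ.1 = ψ ∧ γ.1 ≤ θ}).Nonempty :=
    ⟨_, _, ⟨⊥, trivial, rfl, bot_le (α := Congr L A)⟩, rfl⟩
  obtain ⟨_, ⟨_, ⟨γ, -, rfl, hγ⟩, rfl⟩, hle⟩ := h _ _ hne hd
    ((Congr.gc f).isLUB_l_image hlub) le_rfl
  exact ⟨γ, hγ, le_antisymm ((Congr.gc f).monotone_l hγ) hle⟩

theorem map_surjective {f : A →[L] B} (hf : Function.Surjective f) :
    Function.Surjective (map f) := by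
  apply induction
  · exact ⟨⊥, map_bot _⟩
  · rintro _ _ ⟨γ, rfl⟩ ⟨δ, rfl⟩
    exact ⟨γ ⊔ δ, map_sup _ _ _⟩
  · intro x y
    obtain ⟨x, rfl⟩ := hf x
    obtain ⟨y, rfl⟩ := hf y
    exact ⟨_, map_principal f x y⟩

theorem map_quotHom_le_iff [L.IsAlgebraic] (α : Congr L A) (γ δ : Conc L A) :
    map α.quotHom γ ≤ map α.quotHom δ ↔ γ.1 ≤ δ.1 ⊔ α := by
  rw [← Congr.comap_map_of_surjective α.quotHom_surjective α.quotHom_eq_iff]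
  exact Congr.gc α.quotHom _ _

/-- If `Con f` is an isomorphism, then so is `Con_c f`. -/
theorem isOrderIso_map {f : A →[L] B} (hf : IsOrderIso (Congr.map f : Congr L A → Congr L B)) :
    IsOrderIso (map f) := by
  obtain ⟨e, he⟩ := hf
  have hle : ∀ γ δ : Conc L A, map f γ ≤ map f δ ↔ γ ≤ δ := fun γ δ => by
    change Congr.map f γ.1 ≤ Congr.map f δ.1 ↔ γ.1 ≤ δ.1
    rw [← he, ← he, e.le_iff_le]
  refine ⟨RelIso.ofSurjective (OrderEmbedding.ofMapLEIff (map f) hle) fun δ => ?_, fun _ => rfl⟩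
  obtain ⟨θ, hθ⟩ := e.surjective δ.1
  rw [he] at hθ
  obtain ⟨γ, -, hγ⟩ := exists_le_of_isCompactElement_map f θ (hθ ▸ δ.2)
  exact ⟨γ, Subtype.ext (hγ.trans hθ)⟩

end Conc

/-- Two surjections inducing the same preorder have isomorphic images. -/
theorem exists_orderIso_of_surjective {X Y Z : Type*} [PartialOrder Y] [PartialOrder Z]
    {f : X → Y} {g : X → Z} (hf : Function.Surjective f) (hg : Function.Surjective g)
    (h : ∀ a b, f a ≤ f b ↔ g a ≤ g b) : ∃ e : Y ≃o Z, ∀ a, e (f a) = g a := by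
  have hs : ∀ a, g (Function.surjInv hf (f a)) = g a := fun a =>
    le_antisymm ((h _ _).1 (Function.surjInv_eq hf _).le) ((h _ _).1 (Function.surjInv_eq hf _).ge)
  refine ⟨RelIso.ofSurjective (OrderEmbedding.ofMapLEIff (fun y => g (Function.surjInv hf y)) ?_)
    fun z => ?_, hs⟩
  · intro a b
    rw [← h, Function.surjInv_eq hf, Function.surjInv_eq hf]
  · obtain ⟨a, rfl⟩ := hg z
    exact ⟨f a, hs a⟩

/-! ### Projections of the condensate. -/

namespace NormCovering

variable {I U : Type u} [PartialOrder I] [PartialOrder U] {N : NormCovering I U}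

theorem SharpIdeal.exists_norm_eq (p : N.SharpIdeal) : ∃ x ∈ p.1, N.norm x = p.norm :=
  p.2.choose_spec.1

theorem SharpIdeal.norm_mono {p q : N.SharpIdeal} (h : p ≤ q) : p.norm ≤ q.norm := by
  obtain ⟨x, hx, hxp⟩ := p.exists_norm_eq
  exact hxp ▸ q.norm_le (h hx)

/-- An ideal strictly above `p` whose norm did not grow would contradict extremeness. This makes `κ`
infinite at the norm of every non-maximal extreme ideal. -/
theorem ExtremeIdeal.not_isMax_norm {p : N.ExtremeIdeal} (hp : ¬ IsMax p) :
    ¬ IsMax p.1.norm := by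
  obtain ⟨q, hq⟩ := not_isMax_iff.1 hp
  exact fun h => p.2 ⟨q.1, hq,
    le_antisymm (h (SharpIdeal.norm_mono hq.le)) (SharpIdeal.norm_mono hq.le)⟩

theorem proj_surjective (D : I ⥤ SemilatSupCat.{u}) (p : N.SharpIdeal) :
    Function.Surjective (proj D p) := by
  classical
  intro x
  obtain ⟨v, hv, hvp⟩ := p.exists_norm_eq
  obtain ⟨V, hvV, hV⟩ := N.supported {v}
  rw [Finset.singleton_subset_iff] at hvV
  -- A step function: `x` transported to all points above `v`, and `0` elsewhere. Any kernel
  -- containing `v` supports it.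
  let a : (w : U) → D.obj (N.norm w) := fun w =>
    if h : v ≤ w then D.map (homOfLE (hvp ▸ N.norm.monotone h)) x else ⊥
  have ha : N.IsSupport D V a := by
    refine ⟨hV, fun w q hq => ?_⟩
    by_cases h : v ≤ w
    · have h' : v ≤ q := hq.2 ⟨hvV, h⟩
      simp only [a, dif_pos h, dif_pos h']
      rw [map_map_apply]
    · have h' : ¬ v ≤ q := fun h' => h (h'.trans hq.1.2)
      simp only [a, dif_neg h, dif_neg h']
      exact (map_bot (ConcreteCategory.hom (D.map _))).symm
  obtain ⟨q, hq⟩ := hV.exists_isGreatest p.1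
  refine ⟨⟨a, V, ha⟩, ?_⟩
  rw [proj_eq D p ⟨a, V, ha⟩ ha hq]
  have h' : v ≤ q := hq.2 ⟨hvV, hv⟩
  simp only [a, dif_pos h']
  rw [map_map_apply D _ _ (𝟙 _), map_self_apply]

/-- For a common support `V` containing a point of `p` of norm `p.norm`, the largest element `q` of
`V ∩ p` also has this norm, so comparing projections amounts to comparing the coordinates at `q`.
The correction `c` is `a` with the block of points governed by `q` erased. -/
theorem exists_mem_theta_of_proj_le (D : I ⥤ SemilatSupCat.{u}) (p : N.SharpIdeal)
    {a b : N.Cond D} (h : proj D p a ≤ proj D p b) : ∃ c ∈ theta D p, a ≤ b ⊔ c := by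
  classical
  obtain ⟨v, hv, hvp⟩ := p.exists_norm_eq
  obtain ⟨V₁, hV₁⟩ := a.2
  obtain ⟨V₂, hV₂⟩ := b.2
  obtain ⟨W, -, -, ha, hb⟩ := hV₁.exists_common hV₂
  obtain ⟨V, hWV, hV⟩ := N.supported (insert v W)
  have hvV : v ∈ V := hWV (Finset.mem_insert_self v W)
  replace ha := ha.mono ((Finset.subset_insert v W).trans hWV) hV
  replace hb := hb.mono ((Finset.subset_insert v W).trans hWV) hV
  obtain ⟨q, hq⟩ := hV.exists_isGreatest p.1
  have hqp : p.norm ≤ N.norm q := hvp ▸ N.norm.monotone (hq.2 ⟨hvV, hv⟩)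
  rw [proj_eq D p a ha hq, proj_eq D p b hb hq] at h
  have hab : a.1 q ≤ b.1 q := by
    have := OrderHomClass.mono (ConcreteCategory.hom (D.map (homOfLE hqp))) h
    change D.map (homOfLE hqp) _ ≤ D.map (homOfLE hqp) _ at this
    rwa [map_map_apply D _ _ (𝟙 _), map_map_apply D _ _ (𝟙 _), map_self_apply,
      map_self_apply] at this
  let c : (w : U) → D.obj (N.norm w) := fun w =>
    if IsGreatest {x | x ∈ V ∧ x ≤ w} q then ⊥ else a.1 w
  -- Whether `w` lies in the block of `q` depends only on the largest element of `V` below `w`;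
  -- hence `V` supports `c`.
  have hself : ∀ {w r : U}, IsGreatest {x | x ∈ V ∧ x ≤ w} r →
      (IsGreatest {x | x ∈ V ∧ x ≤ w} q ↔ IsGreatest {x | x ∈ V ∧ x ≤ r} q) := by
    intro w r hr
    have hrr : IsGreatest {x | x ∈ V ∧ x ≤ r} r := ⟨⟨hr.1.1, le_rfl⟩, fun x hx => hx.2⟩
    constructor
    · intro h
      rwa [h.unique hr]
    · intro h
      rwa [h.unique hrr]
  have hc : N.IsSupport D V c := by
    refine ⟨hV, fun w r hr => ?_⟩
    by_cases h : IsGreatest {x | x ∈ V ∧ x ≤ w} q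
    · simp only [c, if_pos h, if_pos ((hself hr).1 h)]
      exact (map_bot (ConcreteCategory.hom (D.map _))).symm
    · simp only [c, if_neg h, if_neg (mt (hself hr).2 h)]
      exact ha.2 w r hr
  refine ⟨⟨c, V, hc⟩, ?_, fun w => ?_⟩
  · change proj D p ⟨c, V, hc⟩ = ⊥
    rw [proj_eq D p ⟨c, V, hc⟩ hc hq]
    have : c q = ⊥ := if_pos ⟨⟨hq.1.1, le_rfl⟩, fun x hx => hx.2⟩
    change D.map _ (c q) = ⊥
    rw [this]
    exact map_bot (ConcreteCategory.hom (D.map _))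
  · change a.1 w ≤ b.1 w ⊔ c w
    by_cases h : IsGreatest {x | x ∈ V ∧ x ≤ w} q
    · rw [ha.2 w q h, hb.2 w q h]
      exact le_sup_of_le_left (OrderHomClass.mono (ConcreteCategory.hom (D.map _)) hab)
    · simp only [c, if_neg h]
      exact le_sup_right

theorem proj_condFunctor_map {D E : I ⥤ SemilatSupCat.{u}} (h : D ⟶ E) (p : N.SharpIdeal)
    (a : N.Cond D) :
    proj E p ((ConcreteCategory.hom (N.condFunctor.map h) : _ → N.Cond E) a) =
      h.app p.norm (proj D p a) := by
  obtain ⟨V, hV⟩ := a.2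
  obtain ⟨q, hq⟩ := hV.1.exists_isGreatest p.1
  have hV' : N.IsSupport E V
      ((ConcreteCategory.hom (N.condFunctor.map h) : _ → N.Cond E) a).1 := by
    refine ⟨hV.1, fun w r hr => ?_⟩
    change h.app (N.norm w) (a.1 w) = E.map _ (h.app (N.norm r) (a.1 r))
    rw [hV.2 w r hr]
    exact ConcreteCategory.congr_hom (h.naturality (homOfLE (N.norm.monotone hr.1.2))) (a.1 r)
  rw [proj_eq D p a hV hq, proj_eq E p _ hV' hq]
  exact (ConcreteCategory.congr_hom (h.naturality (homOfLE (p.norm_le hq.1.2))) (a.1 q)).symm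

/-- If the support meets `q` only inside `p`, then its largest elements in `p` and in `q` coincide.
The condition on `σ` in compatibility provides exactly this. -/
theorem proj_eq_map_proj (D : I ⥤ SemilatSupCat.{u}) {p q : N.SharpIdeal} (hpq : p ≤ q)
    (a : N.Cond D) {V : Finset U} (hV : N.IsSupport D V a.1) (h : ∀ x ∈ V, x ∈ q.1 → x ∈ p.1) :
    proj D q a = D.map (homOfLE (SharpIdeal.norm_mono hpq)) (proj D p a) := by
  obtain ⟨x, hx⟩ := hV.1.exists_isGreatest q.1
  have hx' : IsGreatest {y | y ∈ V ∧ y ∈ p.1} x :=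
    ⟨⟨hx.1.1, h x hx.1.1 hx.1.2⟩, fun y hy => hx.2 ⟨hy.1, hpq hy.2⟩⟩
  rw [proj_eq D q a hV hx, proj_eq D p a hV hx', map_map_apply]

/-! ### Quasi-liftings at an extreme ideal. -/

section QuasiLifting

variable {L : FirstOrder.Language.{v, w}} {D : I ⥤ SemilatSupCat.{u}} {T : Type u}
  [L.Structure T] (τ : SupBotHom (Conc L T) (N.Cond D))

/-- The compact congruences sent into `theta D p` are closed under finite joins, so `δ ∨ α` is a
directed join to which compactness of `γ` applies. -/
theorem exists_le_of_le_sup_alpha (p : N.SharpIdeal) {γ δ : Conc L T}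
    (h : γ.1 ≤ δ.1 ⊔ alpha τ p) : ∃ ε : Conc L T, τ ε ∈ theta D p ∧ γ ≤ δ ⊔ ε := by
  let S : Set (Congr L T) := {ψ | ∃ ε : Conc L T, ψ = δ.1 ⊔ ε.1 ∧ τ ε ∈ theta D p}
  have hS : IsLUB S (δ.1 ⊔ alpha τ p) := by
    constructor
    · rintro _ ⟨ε, rfl, hε⟩
      have hle : ε.1 ≤ alpha τ p := le_sSup ⟨ε, rfl, hε⟩
      exact sup_le_sup_left hle _
    · intro ψ hψ
      refine sup_le ?_ (sSup_le ?_)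
      · refine le_sup_left.trans (hψ ⟨⊥, rfl, ?_⟩)
        rw [map_bot]
        exact (theta D p).bot_mem
      · rintro _ ⟨ε, rfl, hε⟩
        exact le_sup_right.trans (hψ ⟨ε, rfl, hε⟩)
  have hne : S.Nonempty := by
    refine ⟨_, ⊥, rfl, ?_⟩
    rw [map_bot]
    exact (theta D p).bot_mem
  have hd : DirectedOn (· ≤ ·) S := by
    rintro _ ⟨ε, rfl, hε⟩ _ ⟨ζ, rfl, hζ⟩
    refine ⟨_, ⟨ε ⊔ ζ, rfl, ?_⟩, sup_le_sup_left (le_sup_left (α := Congr L T)) _,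
      sup_le_sup_left (le_sup_right (α := Congr L T)) _⟩
    rw [map_sup]
    exact (theta D p).sup_mem hε hζ
  obtain ⟨_, ⟨ε, rfl, hε⟩, hle⟩ := γ.2 S _ hne hd hS h
  exact ⟨ε, hε, hle⟩

theorem proj_sup_of_mem_theta (p : N.SharpIdeal) (a : N.Cond D) {c : N.Cond D}
    (hc : c ∈ theta D p) : proj D p (a ⊔ c) = proj D p a := by
  rw [proj_sup, show proj D p c = ⊥ from hc, sup_bot_eq]

variable {τ}

/-- If `τ γ ≤ τ δ ∨ c` with `c` in `theta`, then adding `γ` to `δ ∨ α` does not enlarge the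
associated ideal, and the order isomorphism reflects this. The converse needs only compactness of
`γ`. -/
theorem IsQuasiLiftingHom.proj_le_iff (h : IsQuasiLiftingHom τ) (p : N.ExtremeIdeal)
    (γ δ : Conc L T) :
    proj D p.1 (τ γ) ≤ proj D p.1 (τ δ) ↔ γ.1 ≤ δ.1 ⊔ alpha τ p.1 := by
  constructor
  · intro hle
    obtain ⟨c, hc, hcle⟩ := exists_mem_theta_of_proj_le D p.1 hle
    obtain ⟨e, he⟩ := h p
    -- The join with `y` puts `γ` above `α`, where the isomorphism is defined; `x ≤ y` still yields
    -- the claim.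
    let x : Set.Ici (alpha τ p.1) := ⟨γ.1 ⊔ (δ.1 ⊔ alpha τ p.1),
      Set.mem_Ici.2 (le_sup_of_le_right le_sup_right)⟩
    let y : Set.Ici (alpha τ p.1) := ⟨δ.1 ⊔ alpha τ p.1, Set.mem_Ici.2 le_sup_right⟩
    have hxy : x ≤ y := by
      rw [← e.le_iff_le, he, he]
      change τ.idealMap (Conc.idealOf (γ.1 ⊔ (δ.1 ⊔ alpha τ p.1))) ⊔ theta D p.1 ≤
        τ.idealMap (Conc.idealOf (δ.1 ⊔ alpha τ p.1)) ⊔ theta D p.1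
      refine sup_le ?_ le_sup_right
      rintro a ⟨ε, hε, ha⟩
      have hε' : ε.1 ≤ (γ ⊔ δ).1 ⊔ alpha τ p.1 := by
        rw [Conc.coe_sup, sup_assoc]
        exact hε
      obtain ⟨ζ, hζ, hle'⟩ := exists_le_of_le_sup_alpha τ p.1 hε'
      have hδ : τ δ ∈ τ.idealMap (Conc.idealOf (δ.1 ⊔ alpha τ p.1)) :=
        ⟨δ, le_sup_left (α := Congr L T), le_rfl⟩
      refine Order.Ideal.lower _ (ha.trans (OrderHomClass.mono τ hle')) ?_
      rw [map_sup, map_sup]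
      refine Order.Ideal.sup_mem (Order.Ideal.sup_mem ?_ ?_) ?_
      · exact Order.Ideal.lower _ hcle
          (Order.Ideal.sup_mem ((le_sup_left : _ ≤ _ ⊔ theta D p.1) hδ)
            ((le_sup_right : theta D p.1 ≤ _ ⊔ _) hc))
      · exact (le_sup_left : _ ≤ _ ⊔ theta D p.1) hδ
      · exact (le_sup_right : theta D p.1 ≤ _ ⊔ _) hζ
    exact le_sup_left.trans (show x.1 ≤ y.1 from hxy)
  · intro hle
    obtain ⟨ε, hε, hle'⟩ := exists_le_of_le_sup_alpha τ p.1 hle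
    refine (proj_mono D p.1 (OrderHomClass.mono τ hle')).trans ?_
    rw [map_sup, proj_sup_of_mem_theta _ _ hε]

/-- Lift `x` to `a` in the condensate and let `β` correspond to the ideal generated by `a` and
`theta`. Some compact `γ ≤ β` has `τ γ` above `a` modulo `theta`, and `τ γ` is below `a` modulo
`theta` as well, so both project to `x`. -/
theorem IsQuasiLiftingHom.proj_surjective (h : IsQuasiLiftingHom τ) (p : N.ExtremeIdeal) :
    Function.Surjective fun γ : Conc L T => proj D p.1 (τ γ) := by
  intro x
  obtain ⟨a, rfl⟩ := NormCovering.proj_surjective D p.1 x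
  obtain ⟨e, he⟩ := h p
  obtain ⟨β, hβ⟩ := e.surjective ⟨Order.Ideal.principal a ⊔ theta D p.1,
    Set.mem_Ici.2 le_sup_right⟩
  rw [he] at hβ
  replace hβ : τ.idealMap (Conc.idealOf β.1) ⊔ theta D p.1 = Order.Ideal.principal a ⊔ theta D p.1 :=
    congrArg Subtype.val hβ
  have ha : a ∈ Order.Ideal.principal a ⊔ theta D p.1 :=
    (le_sup_left : Order.Ideal.principal a ≤ _) (Order.Ideal.mem_principal_self)
  rw [← hβ, Order.Ideal.mem_sup] at ha
  obtain ⟨b, ⟨γ, hγ, hb⟩, c, hc, hle⟩ := ha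
  have hγ' : τ γ ∈ Order.Ideal.principal a ⊔ theta D p.1 :=
    hβ ▸ (le_sup_left : _ ≤ _ ⊔ theta D p.1)
      (show τ γ ∈ τ.idealMap (Conc.idealOf β.1) from ⟨γ, hγ, le_rfl⟩)
  rw [Order.Ideal.mem_sup] at hγ'
  obtain ⟨a', ha', c', hc', hle'⟩ := hγ'
  refine ⟨γ, le_antisymm ?_ ?_⟩
  · refine (proj_mono D p.1 (hle'.trans (sup_le_sup_right (Order.Ideal.mem_principal.1 ha') _))).trans ?_
    rw [proj_sup_of_mem_theta _ _ hc']
  · refine (proj_mono D p.1 (hle.trans (sup_le_sup_right hb _))).trans ?_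
    rw [proj_sup_of_mem_theta _ _ hc]

/-- The isomorphism from the compact congruences of `T / α` onto `D (norm p)`. -/
theorem IsQuasiLiftingHom.exists_orderIso [L.IsAlgebraic] (h : IsQuasiLiftingHom τ)
    (p : N.ExtremeIdeal) :
    ∃ e : Conc L (alpha τ p.1).QuotAlg ≃o D.obj p.1.norm,
      ∀ γ, e (Conc.map (alpha τ p.1).quotHom γ) = proj D p.1 (τ γ) :=
  exists_orderIso_of_surjective (Conc.map_surjective (alpha τ p.1).quotHom_surjective)
    (h.proj_surjective p) fun γ δ => by rw [Conc.map_quotHom_le_iff, h.proj_le_iff]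

/-- The case `δ = ⊥` of `proj_le_iff`. It turns preservation of `α` by a map into an equation in
`D`. -/
theorem IsQuasiLiftingHom.alpha_rel_iff (h : IsQuasiLiftingHom τ) (p : N.ExtremeIdeal) (x y : T) :
    (alpha τ p.1).r x y ↔ proj D p.1 (τ (Conc.principal x y)) = ⊥ := by
  rw [← le_bot_iff, ← proj_bot D p.1, ← map_bot τ, h.proj_le_iff, ← Congr.gen_pair_le_iff]
  change _ ↔ Congr.gen {(x, y)} ≤ ⊥ ⊔ _
  rw [bot_sup_eq]

end QuasiLifting

end NormCovering

/-! ### Subalgebras: the trivial case, cardinality, subquotient diagrams. -/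

namespace Congr

variable {L : FirstOrder.Language.{v, w}} {A B : Type u} [L.Structure A] [L.Structure B]

theorem isOrderIso_map_of_bijective {f : A →[L] B} (hf : Function.Bijective f) :
    IsOrderIso (map f : Congr L A → Congr L B) := by
  let ε : Congr L A :=
    { r := Eq
      iseqv := eq_equivalence
      funMap_rel := fun g x y h => by rw [funext h] }
  have hε : ε = ⊥ := le_bot_iff.1 <| le_def.2 fun x y h => by
    obtain rfl : x = y := h
    exact (⊥ : Congr L A).iseqv.refl x
  have hcm : ∀ θ, comap f (map f θ) = θ := fun θ => by
    rw [comap_map_of_surjective hf.2 (α := ε) (fun x y => hf.1.eq_iff), hε, sup_bot_eq]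
  have hmc : ∀ ψ, map f (comap f ψ) = ψ := fun ψ =>
    le_antisymm ((gc f).l_u_le ψ) <| le_def.2 fun a b h => by
      obtain ⟨x, rfl⟩ := hf.2 a
      obtain ⟨y, rfl⟩ := hf.2 b
      exact le_def.1 ((gc f).le_u_l (comap f ψ)) _ _ h
  refine ⟨⟨⟨map f, comap f, hcm, hmc⟩, fun {θ ψ} => ?_⟩, fun _ => rfl⟩
  change map f θ ≤ map f ψ ↔ θ ≤ ψ
  rw [gc f _ _, hcm]

theorem canonicalEmbedding_quotHom [L.IsAlgebraic] (S : L.Substructure A) (θ : Congr L A)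
    (x : S) : θ.canonicalEmbedding S (quotHom _ x) = θ.quotHom x := rfl

theorem canonicalEmbedding_top_bijective [L.IsAlgebraic] (θ : Congr L A) :
    Function.Bijective (θ.canonicalEmbedding ⊤) := by
  constructor
  · intro a b h
    obtain ⟨x, rfl⟩ := quotHom_surjective _ a
    obtain ⟨y, rfl⟩ := quotHom_surjective _ b
    rw [canonicalEmbedding_quotHom, canonicalEmbedding_quotHom, quotHom_eq_iff] at h
    exact (quotHom_eq_iff _ _ _).2 h
  · intro a
    obtain ⟨x, rfl⟩ := quotHom_surjective _ a
    exact ⟨quotHom _ ⟨x, trivial⟩, rfl⟩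

end Congr

/-- Used at maximal extreme ideals, about which the Löwenheim–Skolem property says nothing. -/
theorem ClosedUnderHomImages.quotient_top {L : FirstOrder.Language.{v, w}} [L.IsAlgebraic]
    {V : Alg.{u} L → Prop} (hV : ClosedUnderHomImages V) (A : Alg.{u} L) (hA : V A)
    (θ : Congr L A) :
    V (Alg.of (θ.comap (⊤ : L.Substructure A).subtype.toHom).QuotAlg) := by
  refine hV A _ ((Congr.quotHom _).comp
    (FirstOrder.Language.Hom.codRestrict ⊤ (FirstOrder.Language.Hom.id L A)
      fun _ => trivial)) ?_ hA
  intro a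
  obtain ⟨x, rfl⟩ := Congr.quotHom_surjective _ a
  exact ⟨x.1, rfl⟩

/-- The pairs embed in the square of the disjoint union, so there are fewer than `κ` of them. If
they are infinite in number, a union of finite sets over them is no larger; otherwise the union is
finite. -/
theorem Cardinal.mk_iUnion_finset_pairs_lt {J U : Type u} {X : J → Type u} {κ : Cardinal.{u}}
    (hκ : ℵ₀ ≤ κ) (h : Cardinal.sum (fun j => #(X j)) < κ)
    (W : (s : Σ j, X j × X j) → Finset U) : #(⋃ s, (W s : Set U)) < κ := by
  have hle : #(Σ j, X j × X j) < κ := by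
    rw [← mk_sigma] at h
    have hinj : Function.Injective fun s : Σ j, X j × X j =>
        ((⟨s.1, s.2.1⟩, ⟨s.1, s.2.2⟩) : (Σ j, X j) × Σ j, X j) := by
      rintro ⟨j, x, y⟩ ⟨k, z, t⟩ h
      simp only [Prod.mk.injEq, Sigma.mk.injEq] at h
      obtain ⟨⟨rfl, h1⟩, -, h2⟩ := h
      rw [eq_of_heq h1, eq_of_heq h2]
    refine (mk_le_of_injective hinj).trans_lt ?_
    rw [← mul_def]
    exact mul_lt_of_lt hκ h h
  rcases finite_or_infinite (Σ j, X j × X j) with hfin | hinf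
  · exact (Set.Finite.lt_aleph0 (Set.finite_iUnion fun s => (W s).finite_toSet)).trans_le hκ
  · refine (mk_iUnion_le_sum_mk.trans ((sum_le_sum _ (fun _ => ℵ₀) fun s =>
      ((W s).finite_toSet.lt_aleph0).le).trans_eq ?_)).trans_lt hle
    rw [sum_const', mul_aleph0_eq (aleph0_le_mk _)]

/-- The diagram of subquotients of a functor `A`, for a family of subalgebras and congruences that
is preserved by the morphisms. -/
def subquotientFunctor {L : FirstOrder.Language.{v, w}} [L.IsAlgebraic] {I J : Type u}
    [PartialOrder I] [SmallCategory J] (A : J ⥤ Alg.{u} L)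
    (S : (i : I) → (j : J) → L.Substructure (A.obj j))
    (θ : (i : I) → (j : J) → Congr L (A.obj j))
    (hS : ∀ {i i' : I} {j k : J} (f : j ⟶ k), i ≤ i' → ∀ x ∈ S i j, A.map f x ∈ S i' k)
    (hθ : ∀ {i i' : I} {j k : J} (f : j ⟶ k), i ≤ i' → ∀ x ∈ S i j, ∀ y ∈ S i j,
      (θ i j).r x y → (θ i' k).r (A.map f x) (A.map f y)) : I × J ⥤ Alg.{u} L where
  obj c := Alg.of ((θ c.1 c.2).comap (S c.1 c.2).subtype.toHom).QuotAlg
  map {c d} f := Congr.quotLift _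
    ((Congr.quotHom ((θ d.1 d.2).comap (S d.1 d.2).subtype.toHom)).comp
      (FirstOrder.Language.Hom.codRestrict (S d.1 d.2)
        ((A.map f.2 : A.obj c.2 →[L] A.obj d.2).comp (S c.1 c.2).subtype.toHom)
        fun x => hS f.2 (leOfHom f.1) x x.2))
    fun x y h => (Congr.quotHom_eq_iff _ _ _).2 (hθ f.2 (leOfHom f.1) x x.2 y y.2 h)
  map_id c := by
    refine FirstOrder.Language.Hom.ext fun a => ?_
    obtain ⟨x, rfl⟩ := Congr.quotHom_surjective _ a
    refine congrArg (Congr.quotHom _) (Subtype.ext ?_)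
    exact ConcreteCategory.congr_hom (A.map_id c.2) x.1
  map_comp {c d e} f g := by
    refine FirstOrder.Language.Hom.ext fun a => ?_
    obtain ⟨x, rfl⟩ := Congr.quotHom_surjective _ a
    refine congrArg (Congr.quotHom _) (Subtype.ext ?_)
    exact ConcreteCategory.congr_hom (A.map_comp f.2 g.2) x.1

namespace NormCovering

variable {I U : Type u} [PartialOrder I] [PartialOrder U] {N : NormCovering I U}
  {L : FirstOrder.Language.{v, w}} [L.IsAlgebraic] {D : I ⥤ SemilatSupCat.{u}} {T : Type u}
  [L.Structure T] {τ : SupBotHom (Conc L T) (N.Cond D)}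

/-- The index `i` is separate from `p.1.norm` because `σ i` has norm `i` only up to a proved
equality; `D.map` along it does the transport. -/
theorem IsQuasiLiftingHom.exists_orderIso_substructure (h : IsQuasiLiftingHom τ)
    (p : N.ExtremeIdeal) {i : I} (hi : p.1.norm = i) (S : L.Substructure T)
    (hS : IsOrderIso (Congr.map ((alpha τ p.1).canonicalEmbedding S))) :
    ∃ e : Conc L ((alpha τ p.1).comap S.subtype.toHom).QuotAlg ≃o D.obj i,
      ∀ x y : S, e (Conc.principal (Congr.quotHom _ x) (Congr.quotHom _ y)) =
        D.map (homOfLE hi.le) (proj D p.1 (τ (Conc.principal (x : T) y))) := by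
  subst hi
  obtain ⟨e₁, h₁⟩ := Conc.isOrderIso_map hS
  obtain ⟨e₂, h₂⟩ := h.exists_orderIso p
  refine ⟨e₁.trans e₂, fun x y => ?_⟩
  rw [OrderIso.trans_apply, h₁, Conc.map_principal, map_self_apply, ← h₂, Conc.map_principal]
  rfl

end NormCovering

/-! ### Construction of the lifting. -/

theorem theoremT (L : FirstOrder.Language.{v, w}) [L.IsAlgebraic]
    (V : Alg.{u} L → Prop) (hV : ClosedUnderHomImages V)
    (I U : Type u) [PartialOrder I] [PartialOrder U] (N : NormCovering I U)
    (κ : I → Cardinal.{u}) (hκ : ∀ i, ¬ IsMax i → ℵ₀ ≤ κ i) (hN : N.IsCompatible κ)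
    (J : Type u) [SmallCategory J]
    (hLS : IsLowenheimSkolem V {p : N.ExtremeIdeal // ¬ IsMax p} J (fun p => κ p.1.1.norm))
    (D : J ⥤ I ⥤ SemilatSupCat.{u}) (A : J ⥤ Alg.{u} L)
    (τ : A ⋙ concFunctor L ⟶ D ⋙ N.condFunctor) (hτ : NormCovering.IsQuasiLifting V N D A τ)
    (hD : ∀ i, Cardinal.sum (fun j => #((D.obj j).obj i)) < κ i) :
    ∃ B : I × J ⥤ Alg.{u} L, IsLifting V (hatDiagram D) B := by
  classical
  obtain ⟨hA, hq⟩ := hτ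
  let t : (j : J) → SupBotHom (Conc L (A.obj j)) (N.Cond (D.obj j)) := fun j => τ.app j
  have ht : ∀ j, NormCovering.IsQuasiLiftingHom (t j) := hq
  let α : (p : N.ExtremeIdeal) → (j : J) → Congr L (A.obj j) := fun p j =>
    NormCovering.alpha (t j) p.1
  obtain ⟨B₀, hB₀V, hB₀mono, hB₀map, hB₀iso, hB₀card⟩ := hLS A hA (fun p j => α p.1 j) fun p => by
    refine lt_of_eq_of_lt (congrArg Cardinal.sum (funext fun j => ?_)) (hD p.1.1.norm)
    obtain ⟨e, -⟩ := (ht j).exists_orderIso p.1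
    exact Cardinal.mk_congr e.toEquiv
  let B : (p : N.ExtremeIdeal) → (j : J) → L.Substructure (A.obj j) := fun p j =>
    if h : IsMax p then ⊤ else B₀ ⟨p, h⟩ j
  have hBtop : ∀ {p} j, IsMax p → B p j = ⊤ := fun j h => dif_pos h
  have hBmax : ∀ {p} j (h : ¬ IsMax p), B p j = B₀ ⟨p, h⟩ j := fun j h => dif_neg h
  have hBV : ∀ p j, V (Alg.of ((α p j).comap (B p j).subtype.toHom).QuotAlg) := by
    intro p j
    by_cases h : IsMax p
    · rw [hBtop j h]
      exact hV.quotient_top _ (hA j) _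
    · rw [hBmax j h]
      exact hB₀V ⟨p, h⟩ j
  have hBiso : ∀ p j, IsOrderIso (Congr.map ((α p j).canonicalEmbedding (B p j))) := by
    intro p j
    by_cases h : IsMax p
    · rw [hBtop j h]
      exact Congr.isOrderIso_map_of_bijective (Congr.canonicalEmbedding_top_bijective _)
    · rw [hBmax j h]
      exact hB₀iso ⟨p, h⟩ j
  have hBmono : ∀ {p q} j, p ≤ q → B p j ≤ B q j := by
    intro p q j hpq
    by_cases hq : IsMax q
    · rw [hBtop j hq]
      exact le_top
    · have hp : ¬ IsMax p := fun hp => hq (hp.mono hpq)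
      rw [hBmax j hp, hBmax j hq]
      exact hB₀mono ⟨p, hp⟩ ⟨q, hq⟩ j hpq
  have hBmap : ∀ p {j k : J} (f : j ⟶ k), ∀ x ∈ B p j, A.map f x ∈ B p k := by
    intro p j k f x hx
    by_cases h : IsMax p
    · rw [hBtop k h]
      trivial
    · rw [hBmax j h] at hx
      rw [hBmax k h]
      exact hB₀map ⟨p, h⟩ j k f x hx
  choose W hW using fun (j : J) (γ : Conc L (A.obj j)) => (t j γ).2
  let F₀ : N.ExtremeIdeal → Set U := fun p => ⋃ s : Σ j, B p j × B p j,
    (W s.1 (Conc.principal (s.2.1 : A.obj s.1) (s.2.2 : A.obj s.1)) : Set U)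
  let F : N.ExtremeIdeal →o Set U :=
    -- Compatibility bounds `F` only at non-maximal ideals, so the whole of `U` is allowed at
    -- maximal ones; it keeps `F` monotone.
    { toFun := fun p => if IsMax p then Set.univ else F₀ p
      monotone' := fun p q hpq => by
        by_cases hq : IsMax q
        · simp [hq]
        · have hp : ¬ IsMax p := fun hp => hq (hp.mono hpq)
          simp only [if_neg hp, if_neg hq]
          exact Set.iUnion_subset fun s => Set.subset_iUnion_of_subset
            ⟨s.1, ⟨s.2.1, hBmono s.1 hpq s.2.1.2⟩, ⟨s.2.2, hBmono s.1 hpq s.2.2.2⟩⟩ le_rfl }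
  have hFW : ∀ p j, ∀ x ∈ B p j, ∀ y ∈ B p j, (W j (Conc.principal x y) : Set U) ⊆ F p := by
    intro p j x hx y hy
    by_cases hp : IsMax p
    · exact (Set.subset_univ _).trans (if_pos hp).ge
    · have hF₀ : (W j (Conc.principal x y) : Set U) ⊆ F₀ p :=
        Set.subset_iUnion_of_subset ⟨j, ⟨x, hx⟩, ⟨y, hy⟩⟩ le_rfl
      exact hF₀.trans (if_neg hp).ge
  obtain ⟨σ, hσ, hFσ⟩ := hN F fun p hp => by
    have hFp : F p = F₀ p := if_neg hp
    rw [hFp]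
    refine Cardinal.mk_iUnion_finset_pairs_lt
      (hκ _ (NormCovering.ExtremeIdeal.not_isMax_norm hp)) ?_ _
    simp only [hBmax _ hp]
    exact hB₀card ⟨p, hp⟩
  -- The heart of the proof: by the choice of `σ`, no support point of `τ` at the pair `x, y` lies
  -- in `σ i'` outside `σ i`; naturality of `τ` handles `f`.
  have key : ∀ {i i' : I} (h : i ≤ i') {j k : J} (f : j ⟶ k), ∀ x ∈ B (σ i) j, ∀ y ∈ B (σ i) j,
      NormCovering.proj (D.obj k) (σ i').1 (t k (Conc.principal (A.map f x) (A.map f y))) =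
        (D.map f).app _ ((D.obj j).map
          (homOfLE (NormCovering.SharpIdeal.norm_mono (σ.monotone h)))
          (NormCovering.proj (D.obj j) (σ i).1 (t j (Conc.principal x y)))) := by
    intro i i' h j k f x hx y hy
    rw [← NormCovering.proj_eq_map_proj (D.obj j) (σ.monotone h) (t j (Conc.principal x y))
      (hW j _) fun z hz hz' => hFσ i i' h (Set.mem_inter (hFW _ j x hx y hy hz) hz'),
      ← NormCovering.proj_condFunctor_map]
    congr 1
    have hnat := ConcreteCategory.congr_hom (τ.naturality f) (Conc.principal x y)
    refine Eq.trans ?_ hnat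
    exact congrArg (t k) (Conc.map_principal (A.map f : A.obj j →[L] A.obj k) x y).symm
  have hS : ∀ {i i' : I} {j k : J} (f : j ⟶ k), i ≤ i' →
      ∀ x ∈ B (σ i) j, A.map f x ∈ B (σ i') k :=
    fun f h x hx => hBmono _ (σ.monotone h) (hBmap _ f x hx)
  have hα : ∀ {i i' : I} {j k : J} (f : j ⟶ k), i ≤ i' → ∀ x ∈ B (σ i) j, ∀ y ∈ B (σ i) j,
      (α (σ i) j).r x y → (α (σ i') k).r (A.map f x) (A.map f y) := by
    intro i i' j k f h x hx y hy hxy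
    rw [(ht _).alpha_rel_iff] at hxy ⊢
    rw [key h f x hx y hy, hxy]
    exact (congrArg _ (map_bot (ConcreteCategory.hom ((D.obj j).map _)))).trans
      (map_bot (ConcreteCategory.hom ((D.map f).app _)))
  choose e he using fun (i : I) (j : J) =>
    (ht j).exists_orderIso_substructure (σ i) (hσ i) (B (σ i) j) (hBiso (σ i) j)
  let E := subquotientFunctor A (fun i j => B (σ i) j) (fun i j => α (σ i) j) hS hα
  have hE : ∀ {c d : I × J} (f : c ⟶ d)
      (a b : ((α (σ c.1) c.2).comap (B (σ c.1) c.2).subtype.toHom).QuotAlg),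
      e d.1 d.2 (Conc.map (E.map f) (Conc.principal a b)) =
        (D.map f.2).app d.1 ((D.obj c.2).map f.1 (e c.1 c.2 (Conc.principal a b))) := by
    intro c d f a b
    obtain ⟨x, rfl⟩ := Congr.quotHom_surjective _ a
    obtain ⟨y, rfl⟩ := Congr.quotHom_surjective _ b
    -- Naturality along the equality `norm (σ d.1) = d.1` moves the transport past `D.map f.2`; the
    -- remaining transitions in `D` compose uniquely since `I` is a poset.
    have hnat := ConcreteCategory.congr_hom ((D.map f.2).naturality (homOfLE (hσ d.1).le))
      ((D.obj c.2).map (homOfLE (NormCovering.SharpIdeal.norm_mono (σ.monotone (leOfHom f.1))))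
        (NormCovering.proj (D.obj c.2) (σ c.1).1 (t c.2 (Conc.principal x.1 y.1))))
    refine (congrArg (e d.1 d.2) (Conc.map_principal _ _ _)).trans ((he d.1 d.2 _ _).trans ?_)
    refine Eq.trans ?_ (congrArg (fun z => (D.map f.2).app d.1 ((D.obj c.2).map f.1 z))
      (he c.1 c.2 x y).symm)
    refine (congrArg _ (key (leOfHom f.1) f.2 x.1 x.2 y.1 y.2)).trans (hnat.symm.trans ?_)
    refine congrArg ((D.map f.2).app d.1) ?_
    exact (NormCovering.map_map_apply _ _ _ (homOfLE ((hσ c.1).le.trans (leOfHom f.1))) _).trans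
      (NormCovering.map_map_apply _ _ _ _ _).symm
  exact ⟨E, fun c => hBV _ _, ⟨NatIso.ofComponents
    (fun c => SemilatSupCat.Iso.mk (e c.1 c.2)) fun {c d} f => Conc.hom_ext (hE f)⟩⟩
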